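/- The curve $f:\mathbb{R}\to\mathbb{C}$ given by $f(t)=\zeta(\tfrac12+it)$, where $\zeta$ denotes the (analytically continued) Riemann zeta function, is locally injective on $\mathbb{R}$; that is, for every $t\in\mathbb{R}$ there is an open real interval containing $t$ on which $f$ is one-to-one. -/

import Mathlib

/-- The curve `f(t) = ζ(1/2 + it)`, for real `t`. -/
noncomputable def zetaCurve (t : ℝ) : ℂ :=
  riemannZeta (1 / 2 + Complex.I * (t : ℂ))

/-- A map `f` on the real line is locally injective if every real `t` lies in an open interval
on which `f` is one-to-one. -/
def LocallyInjectiveOnReal (f : ℝ → ℂ) : Prop :=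
  ∀ t : ℝ, ∃ a b : ℝ, t ∈ Set.Ioo a b ∧ Set.InjOn f (Set.Ioo a b)

/-! Write `s = 1/2 + it`. By the functional equation, `Gammaℝ s * ζ(s)` is real on the critical
line, so the argument of `ζ(s)` modulo `π` is minus the phase `θ(t)` of `Gammaℝ s`. If two nearby
parameters give the same nonzero value of `ζ`, their phases differ by a multiple of `π`. This is
impossible for distinct points of a short interval on which `θ'` keeps away from zero. A common
value zero is excluded because zeros are isolated.

The derivative `θ'` behaves like `(1/2) log(|t|/2π)` and changes sign only near `|t| = 2π`. It is
bounded away from zero where `t² ≤ 36` and, on bounded sets, where `t² ≥ 41`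
(`exists_abs_gammaPhaseDeriv_bounds`). No continuous argument of Gamma is constructed: Euler's
product gives approximations with explicit phases, the estimates are uniform in the index, and the
resulting lower bound for a sine survives the limit (`im_mul_conj_ne_zero_of_tendsto`).

In the gap `36 ≤ t² ≤ 41` the phase gives nothing, and `ζ'(s) ≠ 0` is proved instead
(`deriv_riemannZeta_ne_zero`), so that `ζ` itself is injective near `s`. There, in an
Euler–Maclaurin expansion of `ζ'` starting at 3, the term `-log 2 * 2^(-s)` dominates all the
others. Negative `t` in the gap follow by conjugation. -/

/-! ### Euler–Maclaurin summation for powers and logarithms -/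

/-- Fourth order Euler–Maclaurin summation over a unit interval. -/
theorem euler_maclaurin_unit_bound {a M : ℝ} {H h h1 h2 h3 h4 : ℝ → ℂ}
    (dH : ∀ x ∈ Set.Icc a (a + 1), HasDerivAt H (h x) x)
    (d0 : ∀ x ∈ Set.Icc a (a + 1), HasDerivAt h (h1 x) x)
    (d1 : ∀ x ∈ Set.Icc a (a + 1), HasDerivAt h1 (h2 x) x)
    (d2 : ∀ x ∈ Set.Icc a (a + 1), HasDerivAt h2 (h3 x) x)
    (d3 : ∀ x ∈ Set.Icc a (a + 1), HasDerivAt h3 (h4 x) x)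
    (hM : ∀ x ∈ Set.Icc a (a + 1), ‖h4 x‖ ≤ M) :
    ‖(h a + h (a + 1)) / 2 - (H (a + 1) - H a) - (h1 (a + 1) - h1 a) / 12‖ ≤ M / 384 := by
  -- With `u = x - a`, the coefficients are the kernel `k = u²(1-u)²/24` and its derivatives with
  -- alternating signs. Since `k'''' = 1`, everything in `Φ'` cancels except `k * h4`. At the
  -- endpoints `k` and `k'` vanish, which leaves the trapezoidal and `1/12` terms. The maximum of
  -- `k` is `1/384`, at `u = 1/2`.
  set Φ : ℝ → ℂ := fun x =>
    ((x - a) ^ 2 * (1 - (x - a)) ^ 2 / 24 : ℂ) * h3 x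
      - ((x - a) * (1 - (x - a)) * (1 - 2 * (x - a)) / 12 : ℂ) * h2 x
      + ((1 - 6 * (x - a) + 6 * (x - a) ^ 2) / 12 : ℂ) * h1 x
      - ((x - a) - 1 / 2 : ℂ) * h x + H x with hΦ
  have key : ∀ x ∈ Set.Icc a (a + 1),
      HasDerivWithinAt Φ (((x - a) ^ 2 * (1 - (x - a)) ^ 2 / 24 : ℂ) * h4 x)
        (Set.Icc a (a + 1)) x := by
    intro x hx
    have e : HasDerivAt (fun y : ℝ => ((y : ℂ) - a)) 1 x :=
      (Complex.ofRealCLM.hasDerivAt (x := x)).sub_const (a : ℂ)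
    have e1 : HasDerivAt (fun y : ℝ => (1 - ((y : ℂ) - a))) (-1) x := by
      simpa using e.const_sub 1
    have e2 : HasDerivAt (fun y : ℝ => (1 - 2 * ((y : ℂ) - a))) (-(2 * 1)) x := by
      simpa using (e.const_mul 2).const_sub 1
    have k0 := ((e.pow 2).mul (e1.pow 2)).div_const 24
    have k1 := ((e.mul e1).mul e2).div_const 12
    have k2 := (((e.const_mul 6).const_sub 1).add ((e.pow 2).const_mul 6)).div_const 12
    have k3 := e.sub_const (1 / 2 : ℂ)
    have := ((((k0.mul (d3 x hx)).sub (k1.mul (d2 x hx))).add (k2.mul (d1 x hx))).sub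
      (k3.mul (d0 x hx))).add (dH x hx)
    refine (this.congr_deriv ?_).hasDerivWithinAt
    simp only [Pi.mul_apply, Pi.pow_apply, Pi.add_apply]
    push_cast
    ring
  have bound : ∀ x ∈ Set.Ico a (a + 1),
      ‖((x - a) ^ 2 * (1 - (x - a)) ^ 2 / 24 : ℂ) * h4 x‖ ≤ M / 384 := by
    intro x hx
    have hk : ‖((x - a) ^ 2 * (1 - (x - a)) ^ 2 / 24 : ℂ)‖ ≤ 1 / 384 := by
      have : ((x - a) ^ 2 * (1 - (x - a)) ^ 2 / 24 : ℂ)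
          = (((x - a) ^ 2 * (1 - (x - a)) ^ 2 / 24 : ℝ) : ℂ) := by push_cast; ring
      rw [this, Complex.norm_real, Real.norm_of_nonneg (by positivity), ← mul_pow]
      have h0 : 0 ≤ (x - a) * (1 - (x - a)) := mul_nonneg (by linarith [hx.1]) (by linarith [hx.2])
      have h1 : (x - a) * (1 - (x - a)) ≤ 1 / 4 := by nlinarith [sq_nonneg (x - a - 1 / 2)]
      nlinarith
    rw [norm_mul]
    calc _ ≤ 1 / 384 * M :=
          mul_le_mul hk (hM x ⟨hx.1, hx.2.le⟩) (norm_nonneg _) (by norm_num)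
      _ = M / 384 := by ring
  have fin := norm_image_sub_le_of_norm_deriv_le_segment' key bound (a + 1)
    ⟨by linarith, le_rfl⟩
  rw [← norm_neg]
  calc _ = ‖Φ (a + 1) - Φ a‖ := by
        congr 1
        simp only [hΦ]
        push_cast
        ring
    _ ≤ _ := by simpa using fin

/-- The function `x ↦ x ^ (-s)` for positive real `x`. -/
noncomputable def powNeg (s : ℂ) (x : ℝ) : ℂ := Complex.exp (-s * (Real.log x : ℂ))

theorem powNeg_eq_cpow {x : ℝ} (hx : 0 < x) (s : ℂ) : powNeg s x = (x : ℂ) ^ (-s) := by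
  rw [powNeg, Complex.cpow_def_of_ne_zero (by exact_mod_cast hx.ne'), Complex.ofReal_log hx.le]
  ring_nf

theorem norm_powNeg {x : ℝ} (hx : 0 < x) (s : ℂ) : ‖powNeg s x‖ = x ^ (-s.re) := by
  rw [powNeg_eq_cpow hx, Complex.norm_cpow_eq_rpow_re_of_pos hx]; simp

theorem hasDerivAt_powNeg {x : ℝ} (hx : 0 < x) (s : ℂ) :
    HasDerivAt (powNeg s) (powNeg s x * (-s / x)) x := by
  have := ((Real.hasDerivAt_log hx.ne').ofReal_comp.const_mul (-s)).cexp
  refine this.congr_deriv ?_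
  simp [powNeg, div_eq_mul_inv]

theorem hasDerivAt_powNeg_left (s : ℂ) (x : ℝ) :
    HasDerivAt (fun z => powNeg z x) (-(Real.log x : ℂ) * powNeg s x) s := by
  have := ((hasDerivAt_id s).neg.mul_const (Real.log x : ℂ)).cexp
  refine this.congr_deriv ?_
  simp [powNeg]; ring

theorem hasDerivAt_ofReal_log {x : ℝ} (hx : 0 < x) :
    HasDerivAt (fun y : ℝ => (Real.log y : ℂ)) (1 / (x : ℂ)) x := by
  simpa using (Real.hasDerivAt_log hx.ne').ofReal_comp

/-- Differentiation of `(a + b log x) x ^ (-s) / x ^ k`. -/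
theorem hasDerivAt_log_powNeg_div {x : ℝ} (hx : 0 < x) (s a b : ℂ) (k : ℕ) :
    HasDerivAt (fun y : ℝ => (a + b * (Real.log y : ℂ)) * powNeg s y / (y : ℂ) ^ k)
      (((b - (s + k) * a) + (-(s + k) * b) * (Real.log x : ℂ)) * powNeg s x / (x : ℂ) ^ (k + 1))
      x := by
  have hx' : (x : ℂ) ≠ 0 := by exact_mod_cast hx.ne'
  have e : HasDerivAt (fun y : ℝ => (y : ℂ)) 1 x := Complex.ofRealCLM.hasDerivAt (x := x)
  have := (((hasDerivAt_ofReal_log hx).const_mul b).const_add a).mul (hasDerivAt_powNeg hx s)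
    |>.div (e.pow k) (pow_ne_zero k hx')
  refine this.congr_deriv ?_
  rcases k with _ | k
  · simp; field_simp; ring
  · simp only [Pi.mul_apply, Pi.pow_apply, Nat.add_sub_cancel]
    push_cast
    field_simp
    ring

/-- Differentiation of `(a + b log x) x ^ (1 - s)`. -/
theorem hasDerivAt_log_powNeg_mul {x : ℝ} (hx : 0 < x) (s a b : ℂ) :
    HasDerivAt (fun y : ℝ => (a + b * (Real.log y : ℂ)) * powNeg s y * (y : ℂ))
      (((b + (1 - s) * a) + ((1 - s) * b) * (Real.log x : ℂ)) * powNeg s x) x := by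
  have hx' : (x : ℂ) ≠ 0 := by exact_mod_cast hx.ne'
  have e : HasDerivAt (fun y : ℝ => (y : ℂ)) 1 x := Complex.ofRealCLM.hasDerivAt (x := x)
  have := ((((hasDerivAt_ofReal_log hx).const_mul b).const_add a).mul
    (hasDerivAt_powNeg hx s)).mul e
  refine this.congr_deriv ?_
  simp only [Pi.mul_apply]
  field_simp
  ring

/-- Euler–Maclaurin for `(a + b log x) x ^ (-s)`, where `p`, `q` are the coefficients of the
antiderivative. -/
theorem euler_maclaurin_log_powNeg_bound {c M : ℝ} (hc : 0 < c) {s a b p q : ℂ}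
    (hpa : q + (1 - s) * p = a) (hqb : (1 - s) * q = b)
    (hM : ∀ x ∈ Set.Icc c (c + 1),
      ‖((a * (s * (s + 1) * (s + 2) * (s + 3))
          - b * ((s + 1) * (s + 2) * (s + 3) + s * (s + 2) * (s + 3) + s * (s + 1) * (s + 3)
            + s * (s + 1) * (s + 2)))
          + b * (s * (s + 1) * (s + 2) * (s + 3)) * (Real.log x : ℂ))
        * powNeg s x / (x : ℂ) ^ 4‖ ≤ M) :
    ‖((a + b * (Real.log c : ℂ)) * powNeg s c
        + (a + b * (Real.log (c + 1) : ℂ)) * powNeg s (c + 1)) / 2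
      - ((p + q * (Real.log (c + 1) : ℂ)) * powNeg s (c + 1) * (c + 1)
        - (p + q * (Real.log c : ℂ)) * powNeg s c * c)
      - (((b - s * a) + (-s * b) * (Real.log (c + 1) : ℂ)) * powNeg s (c + 1) / (c + 1)
        - ((b - s * a) + (-s * b) * (Real.log c : ℂ)) * powNeg s c / c) / 12‖ ≤ M / 384 := by
  have pos : ∀ x ∈ Set.Icc c (c + 1), 0 < x := fun x hx => hc.trans_le hx.1
  have := euler_maclaurin_unit_bound (a := c) (M := M)
    (H := fun y : ℝ => (p + q * (Real.log y : ℂ)) * powNeg s y * (y : ℂ))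
    (h := fun y : ℝ => (a + b * (Real.log y : ℂ)) * powNeg s y / (y : ℂ) ^ 0)
    (fun x hx => (hasDerivAt_log_powNeg_mul (pos x hx) s p q).congr_deriv
      (by rw [hpa, hqb]; simp))
    (fun x hx => hasDerivAt_log_powNeg_div (pos x hx) s a b 0)
    (fun x hx => hasDerivAt_log_powNeg_div (pos x hx) s _ _ 1)
    (fun x hx => hasDerivAt_log_powNeg_div (pos x hx) s _ _ 2)
    (fun x hx => hasDerivAt_log_powNeg_div (pos x hx) s _ _ 3)
    (fun x hx => by
      convert hM x hx using 4
      push_cast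
      ring)
  simpa using this

/-! ### Expansion of zeta and of its derivative to the left of `Re s = 1` -/

/-- The Euler–Maclaurin approximation to `∑ n ≥ c, n ^ (-s)`. -/
noncomputable def zetaTail (s : ℂ) (c : ℝ) : ℂ :=
  powNeg s c * c / (s - 1) + powNeg s c / 2 + s * powNeg s c / (12 * c)

/-- The derivative of `zetaTail` in `s`. -/
noncomputable def zetaTailDeriv (s : ℂ) (c : ℝ) : ℂ :=
  powNeg s c * (-(Real.log c * c / (s - 1)) - c / (s - 1) ^ 2 - Real.log c / 2 + 1 / (12 * c)
    - s * Real.log c / (12 * c))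

/-- The error of the Euler–Maclaurin approximation on `[c, c + 1]`. -/
noncomputable def zetaTerm (s : ℂ) (c : ℝ) : ℂ :=
  powNeg s c - zetaTail s c + zetaTail s (c + 1)

theorem hasDerivAt_zetaTail {s : ℂ} (hs : s ≠ 1) {c : ℝ} (hc : 0 < c) :
    HasDerivAt (fun z => zetaTail z c) (zetaTailDeriv s c) s := by
  have hs' : s - 1 ≠ 0 := sub_ne_zero.2 hs
  have hc' : (c : ℂ) ≠ 0 := by exact_mod_cast hc.ne'
  have e := hasDerivAt_powNeg_left s c
  have := (((e.mul_const (c : ℂ)).div ((hasDerivAt_id s).sub_const 1) hs').add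
    (e.div_const 2)).add (((hasDerivAt_id s).mul e).div_const (12 * c : ℂ))
  refine this.congr_deriv ?_
  simp only [zetaTailDeriv, id]
  field_simp
  ring

theorem hasDerivAt_zetaTerm {s : ℂ} (hs : s ≠ 1) {c : ℝ} (hc : 0 < c) :
    HasDerivAt (fun z => zetaTerm z c)
      (-(Real.log c : ℂ) * powNeg s c - zetaTailDeriv s c + zetaTailDeriv s (c + 1)) s :=
  ((hasDerivAt_powNeg_left s c).sub (hasDerivAt_zetaTail hs hc)).add
    (hasDerivAt_zetaTail hs (by linarith))

theorem norm_zetaTerm_le {s : ℂ} (hs : s ≠ 1) {c M : ℝ} (hc : 0 < c)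
    (hM : ∀ x ∈ Set.Icc c (c + 1),
      ‖s * (s + 1) * (s + 2) * (s + 3) * powNeg s x / (x : ℂ) ^ 4‖ ≤ M) :
    ‖zetaTerm s c‖ ≤ M / 384 := by
  have hs' : s - 1 ≠ 0 := sub_ne_zero.2 hs
  have hs'' : 1 - s ≠ 0 := sub_ne_zero.2 hs.symm
  have hc' : (c : ℂ) ≠ 0 := by exact_mod_cast hc.ne'
  have hc'' : (c : ℂ) + 1 ≠ 0 := by exact_mod_cast (by linarith : (0 : ℝ) < c + 1).ne'
  have := euler_maclaurin_log_powNeg_bound (M := M) hc (s := s) (a := 1) (b := 0)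
    (p := -1 / (s - 1)) (q := 0) (by field_simp; ring) (by simp)
    (fun x hx => by simpa using hM x hx)
  convert this using 2
  simp only [zetaTerm, zetaTail]
  push_cast
  field_simp
  ring

theorem norm_deriv_zetaTerm_le {s : ℂ} (hs : s ≠ 1) {c M : ℝ} (hc : 0 < c)
    (hM : ∀ x ∈ Set.Icc c (c + 1),
      ‖(((s + 1) * (s + 2) * (s + 3) + s * (s + 2) * (s + 3) + s * (s + 1) * (s + 3)
            + s * (s + 1) * (s + 2))
          - (s * (s + 1) * (s + 2) * (s + 3)) * (Real.log x : ℂ))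
        * powNeg s x / (x : ℂ) ^ 4‖ ≤ M) :
    ‖deriv (fun z => zetaTerm z c) s‖ ≤ M / 384 := by
  have hs' : s - 1 ≠ 0 := sub_ne_zero.2 hs
  have hs'' : 1 - s ≠ 0 := sub_ne_zero.2 hs.symm
  have hc' : (c : ℂ) ≠ 0 := by exact_mod_cast hc.ne'
  have hc'' : (c : ℂ) + 1 ≠ 0 := by exact_mod_cast (by linarith : (0 : ℝ) < c + 1).ne'
  -- The summand is now `-log x * x^(-s)`, the `s`-derivative of `x^(-s)`; `p` and `q` come from
  -- integrating it by parts.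
  have := euler_maclaurin_log_powNeg_bound (M := M) hc (s := s) (a := 0) (b := -1)
    (p := 1 / (s - 1) ^ 2) (q := 1 / (s - 1)) (by field_simp; ring) (by field_simp; ring)
    (fun x hx => by
      convert hM x hx using 4
      ring)
  rw [(hasDerivAt_zetaTerm hs hc).deriv]
  convert this using 2
  simp only [zetaTailDeriv]
  push_cast
  field_simp
  ring

theorem tendsto_zetaTail_atTop {s : ℂ} (hs : 1 < s.re) :
    Filter.Tendsto (fun n : ℕ => zetaTail s ((n : ℝ) + 3)) Filter.atTop (nhds 0) := by
  have hx : Filter.Tendsto (fun n : ℕ => (n : ℝ) + 3) Filter.atTop Filter.atTop :=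
    Filter.tendsto_atTop_add_const_right _ _ tendsto_natCast_atTop_atTop
  have h1 : Filter.Tendsto (fun x : ℝ => powNeg s x * x) Filter.atTop (nhds 0) := by
    rw [tendsto_zero_iff_norm_tendsto_zero]
    have := tendsto_rpow_neg_atTop (show 0 < s.re - 1 by linarith)
    refine this.congr' ?_
    filter_upwards [Filter.eventually_gt_atTop 0] with x hx
    rw [norm_mul, norm_powNeg hx, Complex.norm_real, Real.norm_of_nonneg hx.le, ← Real.rpow_add_one
      hx.ne']
    ring_nf
  have h2 : Filter.Tendsto (fun x : ℝ => powNeg s x) Filter.atTop (nhds 0) := by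
    rw [tendsto_zero_iff_norm_tendsto_zero]
    have := tendsto_rpow_neg_atTop (show 0 < s.re by linarith)
    refine this.congr' ?_
    filter_upwards [Filter.eventually_gt_atTop 0] with x hx
    rw [norm_powNeg hx]
  have h3 : Filter.Tendsto (fun x : ℝ => (12 * (x : ℂ))⁻¹) Filter.atTop (nhds 0) := by
    have := (tendsto_inv_atTop_zero (𝕜 := ℝ)).ofReal.const_mul (12⁻¹ : ℂ)
    simpa [mul_inv, mul_comm] using! this
  have h4 := ((h1.div_const (s - 1)).add (h2.div_const 2)).add ((h2.const_mul s).mul h3)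
  have h5 := h4.comp hx
  simpa [zetaTail, Function.comp_def, div_eq_mul_inv] using! h5

/-- A convex domain on which the Euler–Maclaurin expansion of `ζ` is uniform. -/
def quarterDisc : Set ℂ := {s | 0 < s.re} ∩ {s | 0 < s.im} ∩ Metric.ball 0 10

theorem isOpen_quarterDisc : IsOpen quarterDisc :=
  ((isOpen_lt continuous_const Complex.continuous_re).inter
    (isOpen_lt continuous_const Complex.continuous_im)).inter Metric.isOpen_ball

theorem isPreconnected_quarterDisc : IsPreconnected quarterDisc :=
  (((convex_halfSpace_re_gt 0).inter (convex_halfSpace_im_gt 0)).inter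
    (convex_ball 0 10)).isPreconnected

theorem ne_one_of_mem_quarterDisc {s : ℂ} (hs : s ∈ quarterDisc) : s ≠ 1 := by
  rintro rfl
  simpa using hs.1.2

theorem summable_inv_add_three_pow_four (C : ℝ) :
    Summable (fun i : ℕ => C * (1 / ((i : ℝ) + 3) ^ 4)) := by
  have := (summable_nat_add_iff 3).2 (Real.summable_one_div_nat_pow.2 (show 1 < 4 by norm_num))
  exact (this.congr (fun i => by push_cast; rfl)).mul_left C

theorem norm_zetaTerm_le_of_mem_quarterDisc (i : ℕ) {s : ℂ} (hs : s ∈ quarterDisc) :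
    ‖zetaTerm s ((i : ℝ) + 3)‖ ≤ 50 * (1 / ((i : ℝ) + 3) ^ 4) := by
  have hc : (0 : ℝ) < (i : ℝ) + 3 := by positivity
  have hn : ‖s‖ < 10 := by simpa using hs.2
  have h := norm_zetaTerm_le (ne_one_of_mem_quarterDisc hs) hc
    -- `17160 = 10 * 11 * 12 * 13` bounds the product of the `‖s + k‖`, and `17160 / 384 < 50`.
    (M := 17160 * (1 / ((i : ℝ) + 3) ^ 4)) (fun x hx => by
      have hx0 : 0 < x := hc.trans_le hx.1
      have hx1 : 1 ≤ x := by linarith [hx.1, (Nat.cast_nonneg i : (0 : ℝ) ≤ i)]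
      have hp : ‖powNeg s x‖ ≤ 1 := by
        rw [norm_powNeg hx0]
        exact Real.rpow_le_one_of_one_le_of_nonpos hx1 (by simpa using (hs.1.1 : 0 < s.re).le)
      have n1 : ‖s + 1‖ ≤ 11 := (norm_add_le _ _).trans (by simp; linarith)
      have n2 : ‖s + 2‖ ≤ 12 := (norm_add_le _ _).trans (by simp; linarith)
      have n3 : ‖s + 3‖ ≤ 13 := (norm_add_le _ _).trans (by simp; linarith)
      have hi : 1 / x ^ 4 ≤ 1 / ((i : ℝ) + 3) ^ 4 := by
        have := hx.1
        gcongr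
      rw [div_eq_mul_one_div, norm_mul, norm_mul, norm_mul, norm_mul, norm_mul, norm_div, norm_pow,
        Complex.norm_real, Real.norm_of_nonneg hx0.le, norm_one]
      calc _ ≤ 10 * 11 * 12 * 13 * 1 * (1 / ((i : ℝ) + 3) ^ 4) := by gcongr
        _ = _ := by norm_num)
  have : 0 ≤ 1 / ((i : ℝ) + 3) ^ 4 := by positivity
  linarith

theorem differentiableOn_zetaTerm (i : ℕ) :
    DifferentiableOn ℂ (fun s => zetaTerm s ((i : ℝ) + 3)) quarterDisc := fun _ hs =>
  (hasDerivAt_zetaTerm (ne_one_of_mem_quarterDisc hs)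
    (by positivity)).differentiableAt.differentiableWithinAt

/-- The errors `zetaTerm` telescope against the Dirichlet series, and `zetaTail` vanishes at
infinity when `Re s > 1`. -/
theorem riemannZeta_eq_of_one_lt_re {s : ℂ} (hs : s ∈ quarterDisc) (h1 : 1 < s.re) :
    riemannZeta s = 1 + powNeg s 2 + zetaTail s 3 + ∑' i : ℕ, zetaTerm s ((i : ℝ) + 3) := by
  have hpow : ∀ n : ℕ, 1 / ((n : ℂ) + 1) ^ s = powNeg s ((n : ℝ) + 1) := fun n => by
    rw [powNeg_eq_cpow (by positivity), Complex.cpow_neg, one_div]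
    push_cast
    rfl
  have hsum : Summable (fun n : ℕ => powNeg s ((n : ℝ) + 1)) := by
    have := (summable_nat_add_iff 1).2 (Complex.summable_one_div_nat_cpow.2 h1)
    refine this.congr fun n => ?_
    rw [← hpow]
    push_cast
    rfl
  have hsum3 : Summable (fun n : ℕ => powNeg s ((n : ℝ) + 3)) := by
    refine ((summable_nat_add_iff 2).2 hsum).congr fun n => ?_
    push_cast
    ring_nf
  have hzeta : riemannZeta s = 1 + powNeg s 2 + ∑' n : ℕ, powNeg s ((n : ℝ) + 3) := by
    rw [zeta_eq_tsum_one_div_nat_add_one_cpow h1, tsum_congr hpow, ← hsum.sum_add_tsum_nat_add 2]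
    congr 1
    · simp only [Finset.sum_range_succ, Finset.sum_range_zero]
      norm_num [powNeg]
    · refine tsum_congr fun n => ?_
      push_cast
      ring_nf
  have hterm : Summable (fun i : ℕ => zetaTerm s ((i : ℝ) + 3)) :=
    Summable.of_norm_bounded (summable_inv_add_three_pow_four 50)
      (fun i => norm_zetaTerm_le_of_mem_quarterDisc i hs)
  have hd := hterm.hasSum.sub hsum3.hasSum
  have hlim : Filter.Tendsto (fun N : ℕ => zetaTail s ((N : ℝ) + 3) - zetaTail s 3)
      Filter.atTop (nhds (0 - zetaTail s 3)) := (tendsto_zetaTail_atTop h1).sub_const _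
  have huniq := tendsto_nhds_unique (hd.tendsto_sum_nat.congr fun N => by
    have := Finset.sum_range_sub (fun n : ℕ => zetaTail s ((n : ℝ) + 3)) N
    simp only [Nat.cast_zero, zero_add] at this
    rw [← this]
    refine Finset.sum_congr rfl fun i _ => ?_
    simp only [zetaTerm]
    push_cast
    ring_nf) hlim
  rw [hzeta]
  linear_combination -huniq

theorem riemannZeta_eq_euler_maclaurin {s : ℂ} (hs : s ∈ quarterDisc) :
    riemannZeta s = 1 + powNeg s 2 + zetaTail s 3 + ∑' i : ℕ, zetaTerm s ((i : ℝ) + 3) := by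
  have hz : (2 + Complex.I : ℂ) ∈ quarterDisc := by
    refine ⟨⟨by simp, by simp⟩, ?_⟩
    have := norm_add_le (2 : ℂ) Complex.I
    rw [mem_ball_zero_iff]
    simp at this
    linarith
  have hL : DifferentiableOn ℂ riemannZeta quarterDisc := fun z hz =>
    (differentiableAt_riemannZeta (ne_one_of_mem_quarterDisc hz)).differentiableWithinAt
  have hR : DifferentiableOn ℂ (fun s => 1 + powNeg s 2 + zetaTail s 3
      + ∑' i : ℕ, zetaTerm s ((i : ℝ) + 3)) quarterDisc :=
    DifferentiableOn.add (fun z hz => DifferentiableAt.differentiableWithinAt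
      (((hasDerivAt_powNeg_left z 2).differentiableAt.const_add 1).add
        (hasDerivAt_zetaTail (ne_one_of_mem_quarterDisc hz) (by norm_num)).differentiableAt))
      (Complex.differentiableOn_tsum_of_summable_norm (summable_inv_add_three_pow_four 50)
        differentiableOn_zetaTerm isOpen_quarterDisc
        (fun i w hw => norm_zetaTerm_le_of_mem_quarterDisc i hw))
  -- Identity theorem: both sides are analytic on `quarterDisc` and agree near `2 + i`, where the
  -- Dirichlet series converges.
  refine (hL.analyticOnNhd isOpen_quarterDisc).eqOn_of_preconnected_of_eventuallyEq
    (hR.analyticOnNhd isOpen_quarterDisc) isPreconnected_quarterDisc hz ?_ hs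
  have hre : {z : ℂ | 1 < z.re} ∈ nhds (2 + Complex.I) :=
    (isOpen_lt continuous_const Complex.continuous_re).mem_nhds (by simp)
  filter_upwards [isOpen_quarterDisc.mem_nhds hz, hre] with z h1 h2
  exact riemannZeta_eq_of_one_lt_re h1 h2

theorem hasSum_deriv_zetaTerm {s : ℂ} (hs : s ∈ quarterDisc) :
    HasSum (fun i : ℕ => deriv (fun z => zetaTerm z ((i : ℝ) + 3)) s)
      (deriv riemannZeta s - (-(Real.log 2 : ℂ) * powNeg s 2 + zetaTailDeriv s 3)) := by
  have h := Complex.hasSum_deriv_of_summable_norm (summable_inv_add_three_pow_four 50)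
    differentiableOn_zetaTerm isOpen_quarterDisc
    (fun i w hw => norm_zetaTerm_le_of_mem_quarterDisc i hw) hs
  have hev : (fun w => ∑' i : ℕ, zetaTerm w ((i : ℝ) + 3)) =ᶠ[nhds s]
      fun w => riemannZeta w - (1 + powNeg w 2 + zetaTail w 3) := by
    filter_upwards [isOpen_quarterDisc.mem_nhds hs] with w hw
    rw [riemannZeta_eq_euler_maclaurin hw]
    ring
  have hderiv : HasDerivAt (fun w => riemannZeta w - (1 + powNeg w 2 + zetaTail w 3))
      (deriv riemannZeta s - (-(Real.log 2 : ℂ) * powNeg s 2 + zetaTailDeriv s 3)) s :=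
    (differentiableAt_riemannZeta (ne_one_of_mem_quarterDisc hs)).hasDerivAt.sub
      (((hasDerivAt_powNeg_left s 2).const_add 1).add
        (hasDerivAt_zetaTail (ne_one_of_mem_quarterDisc hs) (by norm_num)))
  rw [hev.deriv_eq, hderiv.deriv] at h
  exact h

/-! ### Numerical proof that the derivative of zeta does not vanish in the gap -/

theorem log_three_bounds : 1.0986 < Real.log 3 ∧ Real.log 3 < 1.0987 := by
  have := abs_le.1 Real.log_three_near_10
  constructor <;> linarith [this.1, this.2]

theorem tsum_inv_add_three_pow_four_le : ∑' i : ℕ, 1 / ((i : ℝ) + 3) ^ 4 ≤ 8 / 375 := by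
  have hpart : ∀ N : ℕ, ∑ i ∈ Finset.range N, 1 / ((i : ℝ) + 3) ^ 4
      ≤ 8 / 375 - 1 / (3 * ((N : ℝ) + 5 / 2) ^ 3) := by
    intro N
    induction N with
    | zero => norm_num
    | succ N ih =>
      rw [Finset.sum_range_succ]
      have hN : (0 : ℝ) ≤ N := Nat.cast_nonneg N
      -- Midpoint rule for the convex function `x^(-4)` on `[N + 5/2, N + 7/2]`; the sum telescopes
      -- to `1 / (3 * (5/2)³) = 8/375`.
      have key : 1 / ((N : ℝ) + 3) ^ 4
          ≤ 1 / (3 * ((N : ℝ) + 5 / 2) ^ 3) - 1 / (3 * ((N : ℝ) + 7 / 2) ^ 3) := by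
        rw [div_sub_div _ _ (by positivity) (by positivity), div_le_div_iff₀ (by positivity)
          (by positivity), ← sub_nonneg]
        have : (1 * (3 * ((N : ℝ) + 7 / 2) ^ 3) - 3 * ((N : ℝ) + 5 / 2) ^ 3 * 1)
              * ((N : ℝ) + 3) ^ 4
            - 1 * (3 * ((N : ℝ) + 5 / 2) ^ 3 * (3 * ((N : ℝ) + 7 / 2) ^ 3))
            = 15 / 2 * ((N : ℝ) + 3) ^ 4 - 27 / 16 * ((N : ℝ) + 3) ^ 2 + 9 / 64 := by ring
        rw [this]
        nlinarith [sq_nonneg ((N : ℝ) + 3), mul_nonneg hN hN]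
      push_cast
      have e : (N : ℝ) + 1 + 5 / 2 = N + 7 / 2 := by ring
      rw [e]
      linarith
  refine Real.tsum_le_of_sum_range_le (fun i => by positivity) fun N => ?_
  have : 0 ≤ 1 / (3 * ((N : ℝ) + 5 / 2) ^ 3) := by positivity
  linarith [hpart N]

/-- This is `log y ≤ y - 1` at `y = √x / e`, with `2 / e < 0.74`. The factor `√x` will cancel
against `|x^(-s)|`. -/
theorem log_le_mul_sqrt {x : ℝ} (hx : 0 < x) : Real.log x ≤ 0.74 * √x := by
  have hs := Real.sqrt_pos.2 hx
  have h := Real.log_le_sub_one_of_pos (div_pos hs (Real.exp_pos 1))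
  rw [Real.log_div hs.ne' (Real.exp_pos 1).ne', Real.log_exp, Real.log_sqrt hx.le] at h
  have he := Real.exp_one_gt_d9
  have : √x / Real.exp 1 ≤ 0.37 * √x := by
    rw [div_le_iff₀ (Real.exp_pos 1)]
    nlinarith
  linarith

theorem rpow_neg_half_eq {x : ℝ} (hx : 0 < x) : x ^ (-(1 / 2) : ℝ) = 1 / √x := by
  rw [Real.rpow_neg hx.le, Real.sqrt_eq_rpow, one_div (x ^ (1 / 2 : ℝ))]

theorem norm_criticalLine_add_le {t : ℝ} (ht : t ^ 2 ≤ 41) {k : ℝ} {b : ℝ} (hb : 0 ≤ b)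
    (h : (1 / 2 + k) ^ 2 + 41 ≤ b ^ 2) : ‖(1 / 2 + Complex.I * (t : ℂ)) + (k : ℂ)‖ ≤ b := by
  have e : (1 / 2 + Complex.I * (t : ℂ)) + (k : ℂ)
      = ((1 / 2 + k : ℝ) : ℂ) + (t : ℂ) * Complex.I := by push_cast; ring
  rw [← sq_le_sq₀ (norm_nonneg _) hb, e, Complex.sq_norm, Complex.normSq_add_mul_I]
  linarith

theorem norm_deriv_zetaTerm_criticalLine_le {t : ℝ} (ht0 : t ≠ 0) (ht : t ^ 2 ≤ 41) (i : ℕ) :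
    ‖deriv (fun z => zetaTerm z ((i : ℝ) + 3)) (1 / 2 + Complex.I * (t : ℂ))‖
      ≤ 5.97 * (1 / ((i : ℝ) + 3) ^ 4) := by
  set s : ℂ := 1 / 2 + Complex.I * (t : ℂ) with hs
  have hs1 : s ≠ 1 := fun h => ht0 (by simpa [hs] using congrArg Complex.im h)
  have hc : (0 : ℝ) < (i : ℝ) + 3 := by positivity
  -- The constant comes from `1251 / 1.731 + 2120 * 0.74 < 2292`, and `2292 / 384 < 5.97`.
  have h := norm_deriv_zetaTerm_le hs1 hc (M := 2292 * (1 / ((i : ℝ) + 3) ^ 4)) (fun x hx => by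
    have hx3 : 3 ≤ x := by linarith [hx.1, (Nat.cast_nonneg i : (0 : ℝ) ≤ i)]
    have hx0 : 0 < x := by linarith
    have n0 : ‖s‖ ≤ 6.423 := by
      simpa [hs] using norm_criticalLine_add_le ht (k := 0) (b := 6.423) (by norm_num) (by norm_num)
    have n1 : ‖s + 1‖ ≤ 6.577 := by
      simpa [hs] using norm_criticalLine_add_le ht (k := 1) (b := 6.577) (by norm_num) (by norm_num)
    have n2 : ‖s + 2‖ ≤ 6.874 := by
      simpa [hs] using norm_criticalLine_add_le ht (k := 2) (b := 6.874) (by norm_num) (by norm_num)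
    have n3 : ‖s + 3‖ ≤ 7.298 := by
      simpa [hs] using norm_criticalLine_add_le ht (k := 3) (b := 7.298) (by norm_num) (by norm_num)
    have hA : ‖(s + 1) * (s + 2) * (s + 3) + s * (s + 2) * (s + 3) + s * (s + 1) * (s + 3)
            + s * (s + 1) * (s + 2)‖ ≤ 1251 := by
      calc _ ≤ ‖(s + 1) * (s + 2) * (s + 3)‖ + ‖s * (s + 2) * (s + 3)‖ + ‖s * (s + 1) * (s + 3)‖
            + ‖s * (s + 1) * (s + 2)‖ := norm_add₄_le
        _ ≤ 6.577 * 6.874 * 7.298 + 6.423 * 6.874 * 7.298 + 6.423 * 6.577 * 7.298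
            + 6.423 * 6.577 * 6.874 := by
          simp only [norm_mul]
          gcongr
        _ ≤ _ := by norm_num
    have hB : ‖s * (s + 1) * (s + 2) * (s + 3)‖ ≤ 2120 := by
      calc ‖s * (s + 1) * (s + 2) * (s + 3)‖ ≤ 6.423 * 6.577 * 6.874 * 7.298 := by
            simp only [norm_mul]
            gcongr
        _ ≤ _ := by norm_num
    have hlog : ‖(Real.log x : ℂ)‖ ≤ 0.74 * √x := by
      rw [Complex.norm_real, Real.norm_of_nonneg (Real.log_nonneg (by linarith))]
      exact log_le_mul_sqrt hx0
    have hsq : 1.731 ≤ √x := Real.le_sqrt_of_sq_le (by norm_num; linarith)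
    have hsq0 : 0 < √x := by linarith
    have hpow : ‖powNeg s x‖ = 1 / √x := by
      rw [norm_powNeg hx0, ← rpow_neg_half_eq hx0]
      simp [hs]
    have hi : 1 / x ^ 4 ≤ 1 / ((i : ℝ) + 3) ^ 4 := by
      have := hx.1
      gcongr
    rw [div_eq_mul_one_div, norm_mul, norm_mul, norm_div, norm_pow, norm_one, hpow,
      Complex.norm_real, Real.norm_of_nonneg hx0.le]
    have hmain : ‖((s + 1) * (s + 2) * (s + 3) + s * (s + 2) * (s + 3) + s * (s + 1) * (s + 3)
            + s * (s + 1) * (s + 2))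
          - (s * (s + 1) * (s + 2) * (s + 3)) * (Real.log x : ℂ)‖ ≤ 2292 * √x := by
      refine (norm_sub_le _ _).trans ?_
      rw [norm_mul]
      have := mul_le_mul hB hlog (norm_nonneg _) (by norm_num)
      linarith
    calc _ ≤ 2292 * √x * (1 / √x) * (1 / ((i : ℝ) + 3) ^ 4) := by gcongr
      _ = _ := by field_simp)
  have : 0 ≤ 1 / ((i : ℝ) + 3) ^ 4 := by positivity
  refine h.trans ?_
  linarith

/-- Here `L` stands for `log 3` and `r` for `1 / |s - 1|² = 1 / (1/4 + t²)`. The expression is the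
real part of `zetaTailDeriv s 3 / powNeg s 3`; `tail_im_bounds` treats the imaginary part divided by
`t`. -/
theorem tail_re_bounds {L r : ℝ} (L1 : 1.0986 < L) (L2 : L < 1.0987) (r1 : 0.0242 ≤ r)
    (r2 : r ≤ 0.0276) :
    3 / 2 * L * r + 3 * r - 3 / 2 * r ^ 2 - L * (1 / 2 + 1 / 72) + 1 / 36 ≤ 0 ∧
      -0.43 ≤ 3 / 2 * L * r + 3 * r - 3 / 2 * r ^ 2 - L * (1 / 2 + 1 / 72) + 1 / 36 := by
  have h1 : 1.0986 * 0.0242 ≤ L * r := by gcongr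
  have h2 : L * r ≤ 1.0987 * 0.0276 := by gcongr
  have h3 : r ^ 2 ≤ 0.0276 ^ 2 := by gcongr
  have h4 : 0 ≤ r ^ 2 := sq_nonneg r
  norm_num at *
  constructor <;> linarith

theorem tail_im_bounds {L r : ℝ} (L1 : 1.0986 < L) (L2 : L < 1.0987) (r1 : 0.0242 ≤ r)
    (r2 : r ≤ 0.0276) :
    0 ≤ 3 * L * r - 3 * r ^ 2 - L / 36 ∧ 3 * L * r - 3 * r ^ 2 - L / 36 ≤ 0.0595 := by
  have h1 : 1.0986 * 0.0242 ≤ L * r := by gcongr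
  have h2 : L * r ≤ 1.0987 * 0.0276 := by gcongr
  have h3 : r ^ 2 ≤ 0.0276 ^ 2 := by gcongr
  have h4 : 0.0242 ^ 2 ≤ r ^ 2 := by gcongr
  norm_num at *
  constructor <;> linarith

theorem norm_zetaTailDeriv_three_le {t : ℝ} (ht0 : 0 < t) (h36 : 36 ≤ t ^ 2) (h41 : t ^ 2 ≤ 41) :
    ‖zetaTailDeriv (1 / 2 + Complex.I * (t : ℂ)) 3‖ ≤ 0.338 := by
  set r : ℝ := 1 / (1 / 4 + t ^ 2) with hr
  set L := Real.log 3 with hL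
  obtain ⟨L1, L2⟩ := log_three_bounds
  have hq : 0 < 1 / 4 + t ^ 2 := by positivity
  have hrt : r * (1 / 4 + t ^ 2) = 1 := by rw [hr]; field_simp
  have r1 : 0.0242 ≤ r := by rw [hr, le_div_iff₀ hq]; linarith
  have r2 : r ≤ 0.0276 := by rw [hr, div_le_iff₀ hq]; linarith
  have ht : t ≤ 6.41 := by nlinarith
  set w : ℂ := (-(1 / 2) - (t : ℂ) * Complex.I) * (r : ℂ) with hw
  have hrtC : (r : ℂ) * (1 / 4 + (t : ℂ) ^ 2) = 1 := by
    have := congrArg (fun z : ℝ => (z : ℂ)) hrt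
    push_cast at this
    exact this
  have hinv : (1 / 2 + Complex.I * (t : ℂ) - 1) * w = 1 := by
    rw [hw]
    linear_combination hrtC - (r : ℂ) * (t : ℂ) ^ 2 * Complex.I_sq
  have hne : (1 / 2 + Complex.I * (t : ℂ) - 1) ≠ 0 := left_ne_zero_of_mul_eq_one hinv
  have hw' : (1 / 2 + Complex.I * (t : ℂ) - 1)⁻¹ = w := inv_eq_of_mul_eq_one_right hinv
  set X : ℝ := 3 / 2 * L * r + 3 * r - 3 / 2 * r ^ 2 - L * (1 / 2 + 1 / 72) + 1 / 36 with hX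
  set Y : ℝ := t * (3 * L * r - 3 * r ^ 2 - L / 36) with hY
  have hE : ‖powNeg (1 / 2 + Complex.I * (t : ℂ)) 3‖ ≤ 0.5775 := by
    rw [norm_powNeg (by norm_num)]
    have : -(1 / 2 + Complex.I * (t : ℂ)).re = -(1 / 2 : ℝ) := by simp
    rw [this, rpow_neg_half_eq (by norm_num)]
    have h3 : (1.732 : ℝ) ≤ √3 := Real.le_sqrt_of_sq_le (by norm_num)
    rw [div_le_iff₀ (by linarith)]
    linarith
  have hval : zetaTailDeriv (1 / 2 + Complex.I * (t : ℂ)) 3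
      = powNeg (1 / 2 + Complex.I * (t : ℂ)) 3 * ((X : ℂ) + (Y : ℂ) * Complex.I) := by
    rw [zetaTailDeriv, div_eq_mul_inv _ ((1 / 2 + Complex.I * (t : ℂ) - 1) : ℂ),
      div_eq_mul_inv _ ((1 / 2 + Complex.I * (t : ℂ) - 1) ^ 2 : ℂ), ← inv_pow, hw', ← hL, hw, hX, hY]
    congr 1
    push_cast
    linear_combination (-3 * (r : ℂ) ^ 2 * (t : ℂ) ^ 2) * Complex.I_sq + 3 * (r : ℂ) * hrtC
  obtain ⟨hX1, hX2⟩ := tail_re_bounds L1 L2 r1 r2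
  obtain ⟨hY0, hY1⟩ := tail_im_bounds L1 L2 r1 r2
  rw [← hX] at hX1 hX2
  have hY2 : Y ≤ 0.3815 := by
    have : Y ≤ 6.41 * 0.0595 := by rw [hY]; gcongr
    norm_num at this ⊢
    linarith
  have hY3 : 0 ≤ Y := mul_nonneg ht0.le hY0
  have hP : ‖(X : ℂ) + (Y : ℂ) * Complex.I‖ ≤ 0.585 := by
    rw [← sq_le_sq₀ (norm_nonneg _) (by norm_num), Complex.sq_norm, Complex.normSq_add_mul_I]
    have hXX : X ^ 2 ≤ 0.43 ^ 2 := sq_le_sq' hX2 (by linarith)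
    have hYY : Y ^ 2 ≤ 0.3815 ^ 2 := by gcongr
    norm_num at hXX hYY ⊢
    linarith
  rw [hval, norm_mul]
  exact (mul_le_mul hE hP (norm_nonneg _) (by norm_num)).trans (by norm_num)

theorem deriv_riemannZeta_ne_zero {t : ℝ} (ht0 : 0 < t) (h36 : 36 ≤ t ^ 2) (h41 : t ^ 2 ≤ 41) :
    deriv riemannZeta (1 / 2 + Complex.I * (t : ℂ)) ≠ 0 := by
  intro h0
  have hmem : (1 / 2 + Complex.I * (t : ℂ)) ∈ quarterDisc := by
    refine ⟨⟨by simp, by simpa using ht0⟩, ?_⟩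
    have := norm_criticalLine_add_le h41 (k := 0) (b := 7) (by norm_num) (by norm_num)
    rw [mem_ball_zero_iff]
    simp only [Complex.ofReal_zero, add_zero] at this
    linarith
  have hsum := hasSum_deriv_zetaTerm hmem
  rw [h0, zero_sub] at hsum
  have hle := hsum.norm_le_of_bounded (summable_inv_add_three_pow_four 5.97).hasSum
    (norm_deriv_zetaTerm_criticalLine_le ht0.ne' h41)
  rw [tsum_mul_left, norm_neg] at hle
  have h3 := norm_zetaTailDeriv_three_le ht0 h36 h41
  have h2 : 0.49 ≤ ‖-(Real.log 2 : ℂ) * powNeg (1 / 2 + Complex.I * (t : ℂ)) 2‖ := by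
    rw [norm_mul, norm_neg, Complex.norm_real, norm_powNeg (by norm_num)]
    have : -(1 / 2 + Complex.I * (t : ℂ)).re = -(1 / 2 : ℝ) := by simp
    have hlog := Real.log_two_gt_d9
    rw [this, rpow_neg_half_eq (by norm_num), Real.norm_of_nonneg (by linarith), mul_one_div,
      le_div_iff₀ (by positivity)]
    have h2 : √2 ≤ 1.4143 := Real.sqrt_le_iff.2 (by norm_num)
    linarith
  have h4 := norm_sub_le_norm_add (-(Real.log 2 : ℂ) * powNeg (1 / 2 + Complex.I * (t : ℂ)) 2)
    (zetaTailDeriv (1 / 2 + Complex.I * (t : ℂ)) 3)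
  -- Vanishing would force `0.49 - 0.338 ≤ 5.97 * 8/375`, but the right side is below `0.128`.
  linarith [tsum_inv_add_three_pow_four_le]

/-! ### Monotonicity of the Gamma phase away from `|t| = 2π` -/

/-- The phase of the `n`-th Euler approximation to `Gammaℝ (1 / 2 + i t)`. -/
noncomputable def gammaPhase (n : ℕ) (t : ℝ) : ℝ :=
  t / 2 * (Real.log n - Real.log Real.pi)
    - ∑ j ∈ Finset.range (n + 1), Real.arctan (t / 2 / (1 / 4 + j))

/-- The derivative of `gammaPhase n`. -/
noncomputable def gammaPhaseDeriv (n : ℕ) (t : ℝ) : ℝ :=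
  1 / 2 * (Real.log n - Real.log Real.pi)
    - 1 / 2 * ∑ j ∈ Finset.range (n + 1), 2 * (2 * j + 1 / 2) / ((2 * j + 1 / 2) ^ 2 + t ^ 2)

theorem hasDerivAt_gammaPhase (n : ℕ) (t : ℝ) :
    HasDerivAt (gammaPhase n) (gammaPhaseDeriv n t) t := by
  have h1 := ((hasDerivAt_id t).div_const 2).mul_const (Real.log n - Real.log Real.pi)
  have h2 := HasDerivAt.fun_sum (u := Finset.range (n + 1)) fun j _ =>
    (((hasDerivAt_id t).div_const 2).div_const (1 / 4 + (j : ℝ))).arctan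
  refine (h1.sub h2).congr_deriv ?_
  rw [gammaPhaseDeriv, Finset.mul_sum]
  congr 1
  refine Finset.sum_congr rfl fun j _ => ?_
  have hj : (0 : ℝ) < 1 / 4 + j := by positivity
  have h3 : (0 : ℝ) < (2 * j + 1 / 2) ^ 2 + t ^ 2 := by positivity
  simp only [id]
  field_simp
  ring

/-- An instance of `log (1 + x) ≥ 2x / (x + 2)`. The shift `t² - 1` makes the two sides match
exactly, and the bounds telescope along `u = 2j + 1/2`. -/
theorem two_mul_div_le_half_log {u t : ℝ} (hu : 0 ≤ u) (h : 0 < (u - 1) ^ 2 + (t ^ 2 - 1)) :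
    2 * u / (u ^ 2 + t ^ 2) ≤ 1 / 2 * (Real.log ((u + 1) ^ 2 + (t ^ 2 - 1))
      - Real.log ((u - 1) ^ 2 + (t ^ 2 - 1))) := by
  have h' : 0 < (u + 1) ^ 2 + (t ^ 2 - 1) := by nlinarith
  have hut : 0 < u ^ 2 + t ^ 2 := by nlinarith
  have := Real.le_log_one_add_of_nonneg (x := 4 * u / ((u - 1) ^ 2 + (t ^ 2 - 1))) (by positivity)
  rw [← Real.log_div h'.ne' h.ne']
  have e1 : 1 + 4 * u / ((u - 1) ^ 2 + (t ^ 2 - 1))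
      = ((u + 1) ^ 2 + (t ^ 2 - 1)) / ((u - 1) ^ 2 + (t ^ 2 - 1)) := by
    rw [eq_div_iff h.ne', add_mul, div_mul_cancel₀ _ h.ne']
    ring
  have e2 : 2 * (4 * u / ((u - 1) ^ 2 + (t ^ 2 - 1))) / (4 * u / ((u - 1) ^ 2 + (t ^ 2 - 1)) + 2)
      = 2 * (2 * u / (u ^ 2 + t ^ 2)) := by
    have : 4 * u / ((u - 1) ^ 2 + (t ^ 2 - 1)) + 2
        = 2 * (u ^ 2 + t ^ 2) / ((u - 1) ^ 2 + (t ^ 2 - 1)) := by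
      rw [eq_div_iff h.ne', add_mul, div_mul_cancel₀ _ h.ne']
      ring
    rw [this]
    field_simp
    ring
  rw [e1, e2] at this
  linarith

/-- The telescoping companion from below: it follows from `y ≤ sinh y` at `y = log (A / B)`. -/
theorem half_log_le_two_mul_div {u : ℝ} (t : ℝ) (hu : 0 < u) :
    1 / 2 * (Real.log ((u + 1) ^ 2 + (t ^ 2 + 3)) - Real.log ((u - 1) ^ 2 + (t ^ 2 + 3)))
      ≤ 2 * u / (u ^ 2 + t ^ 2) := by
  set A := (u + 1) ^ 2 + (t ^ 2 + 3) with hA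
  set B := (u - 1) ^ 2 + (t ^ 2 + 3) with hB
  have hB0 : 0 < B := by positivity
  have hA0 : 0 < A := by positivity
  have hut : 0 < u ^ 2 + t ^ 2 := by positivity
  have hAB : B ≤ A := by rw [hA, hB]; nlinarith
  have hlog : 0 ≤ Real.log (A / B) := Real.log_nonneg (by rwa [one_le_div hB0])
  have h := Real.self_le_sinh_iff.2 hlog
  rw [Real.sinh_log (div_pos hA0 hB0)] at h
  rw [← Real.log_div hA0.ne' hB0.ne']
  have e : A / B - (A / B)⁻¹ = 8 * u * (u ^ 2 + t ^ 2 + 4) / (A * B) := by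
    rw [inv_div, div_sub_div _ _ hB0.ne' hA0.ne', mul_comm B A]
    congr 1
    rw [hA, hB]
    ring
  have hle : 8 * u * (u ^ 2 + t ^ 2 + 4) / (A * B) ≤ 4 * (2 * u / (u ^ 2 + t ^ 2)) := by
    rw [← mul_div_assoc, div_le_div_iff₀ (mul_pos hA0 hB0) hut]
    have : A * B - (u ^ 2 + t ^ 2 + 4) * (u ^ 2 + t ^ 2) = 4 * (t ^ 2 + 4) := by
      rw [hA, hB]; ring
    nlinarith [mul_pos hu (show 0 < 4 * (t ^ 2 + 4) by positivity)]
  rw [e] at h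
  linarith

theorem half_log_le_sum (n : ℕ) (t : ℝ) :
    1 / 2 * (Real.log ((2 * n + 3 / 2) ^ 2 + (t ^ 2 + 3)) - Real.log (t ^ 2 + 13 / 4))
      ≤ ∑ j ∈ Finset.range (n + 1), 2 * (2 * j + 1 / 2) / ((2 * j + 1 / 2) ^ 2 + t ^ 2) := by
  induction n with
  | zero =>
    have := half_log_le_two_mul_div t (u := 1 / 2) (by norm_num)
    simp only [Finset.sum_range_one, zero_add]
    convert this using 3 <;> norm_num
    ring_nf
  | succ n ih =>
    rw [Finset.sum_range_succ]
    have := half_log_le_two_mul_div t (u := 2 * ((n + 1 : ℕ) : ℝ) + 1 / 2) (by positivity)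
    have e1 : 2 * ((n + 1 : ℕ) : ℝ) + 1 / 2 + 1 = 2 * ((n + 1 : ℕ) : ℝ) + 3 / 2 := by ring
    have e2 : 2 * ((n + 1 : ℕ) : ℝ) + 1 / 2 - 1 = 2 * (n : ℝ) + 3 / 2 := by push_cast; ring
    rw [e1, e2] at this
    linarith

theorem sum_le_half_log {t : ℝ} (ht : 3 / 4 < t ^ 2) (n : ℕ) :
    ∑ j ∈ Finset.range (n + 1), 2 * (2 * (j : ℝ) + 1 / 2) / ((2 * j + 1 / 2) ^ 2 + t ^ 2)
      ≤ 1 / 2 * (Real.log ((2 * n + 3 / 2) ^ 2 + (t ^ 2 - 1)) - Real.log (t ^ 2 - 3 / 4)) := by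
  induction n with
  | zero =>
    have := two_mul_div_le_half_log (t := t) (u := 1 / 2) (by norm_num) (by norm_num; linarith)
    simp only [Finset.sum_range_one, zero_add]
    convert this using 3 <;> norm_num
    ring_nf
  | succ n ih =>
    rw [Finset.sum_range_succ]
    have := two_mul_div_le_half_log (t := t) (u := 2 * ((n + 1 : ℕ) : ℝ) + 1 / 2) (by positivity)
      (by push_cast; nlinarith [(Nat.cast_nonneg n : (0 : ℝ) ≤ n)])
    have e1 : 2 * ((n + 1 : ℕ) : ℝ) + 1 / 2 + 1 = 2 * ((n + 1 : ℕ) : ℝ) + 3 / 2 := by ring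
    have e2 : 2 * ((n + 1 : ℕ) : ℝ) + 1 / 2 - 1 = 2 * (n : ℝ) + 3 / 2 := by push_cast; ring
    rw [e1, e2] at this
    linarith

/-- The logarithmic comparison fails to apply to the term `j = 0` when `t` is small, so that term is
bounded crudely by 4. This serves only to bound the size of the phase derivative. -/
theorem sum_le_add_half_log (t : ℝ) (n : ℕ) :
    ∑ j ∈ Finset.range (n + 1), 2 * (2 * (j : ℝ) + 1 / 2) / ((2 * j + 1 / 2) ^ 2 + t ^ 2)
      ≤ 4 + 1 / 2 * (Real.log ((2 * n + 3 / 2) ^ 2 + (t ^ 2 - 1)) - Real.log (t ^ 2 + 5 / 4)) := by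
  induction n with
  | zero =>
    have e : (2 * ((0 : ℕ) : ℝ) + 3 / 2) ^ 2 + (t ^ 2 - 1) = t ^ 2 + 5 / 4 := by
      push_cast
      ring
    rw [e, sub_self, mul_zero, add_zero]
    simp only [Finset.sum_range_one, zero_add]
    rw [div_le_iff₀ (by positivity)]
    push_cast
    nlinarith [sq_nonneg t]
  | succ n ih =>
    rw [Finset.sum_range_succ]
    have := two_mul_div_le_half_log (t := t) (u := 2 * ((n + 1 : ℕ) : ℝ) + 1 / 2) (by positivity)
      (by push_cast; nlinarith [(Nat.cast_nonneg n : (0 : ℝ) ≤ n), sq_nonneg t])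
    have e1 : 2 * ((n + 1 : ℕ) : ℝ) + 1 / 2 + 1 = 2 * ((n + 1 : ℕ) : ℝ) + 3 / 2 := by ring
    have e2 : 2 * ((n + 1 : ℕ) : ℝ) + 1 / 2 - 1 = 2 * (n : ℝ) + 3 / 2 := by push_cast; ring
    rw [e1, e2] at this
    linarith

theorem gammaPhaseDeriv_le {n : ℕ} (hn : 1 ≤ n) (t : ℝ) :
    gammaPhaseDeriv n t
      ≤ 1 / 4 * (Real.log (t ^ 2 + 13 / 4) - Real.log (4 * Real.pi ^ 2)) := by
  have hn0 : (0 : ℝ) < n := by exact_mod_cast hn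
  have h := half_log_le_sum n t
  have h1 : Real.log (4 * (n : ℝ) ^ 2) ≤ Real.log ((2 * n + 3 / 2) ^ 2 + (t ^ 2 + 3)) :=
    Real.log_le_log (by positivity) (by nlinarith [sq_nonneg t])
  rw [Real.log_mul (by norm_num) (by positivity), Real.log_pow] at h1
  rw [Real.log_mul (by norm_num) (by positivity), Real.log_pow, gammaPhaseDeriv]
  push_cast at h1 ⊢
  linarith

/-- Taking `n` this large replaces `(2n + 3/2)² + t² - 1` by `4.01 n²`, so the dependence on `n`
cancels. -/
theorem le_gammaPhaseDeriv {K t : ℝ} (ht : t ^ 2 ≤ K) {n : ℕ} (hn : 1000 * (K + 1) ≤ n) :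
    -(2 + 1 / 4 * Real.log (4.01 * Real.pi ^ 2)) ≤ gammaPhaseDeriv n t ∧
      (41 ≤ t ^ 2 → 1 / 4 * (Real.log 40.25 - Real.log (4.01 * Real.pi ^ 2))
        ≤ gammaPhaseDeriv n t) := by
  have hK : 0 ≤ K := (sq_nonneg t).trans ht
  have hn0 : (0 : ℝ) < n := by linarith
  have hbig : (2 * (n : ℝ) + 3 / 2) ^ 2 + (t ^ 2 - 1) ≤ 4.01 * (n : ℝ) ^ 2 := by
    norm_num
    nlinarith
  have h1 : Real.log ((2 * (n : ℝ) + 3 / 2) ^ 2 + (t ^ 2 - 1)) ≤ Real.log (4.01 * (n : ℝ) ^ 2) :=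
    Real.log_le_log (by nlinarith [sq_nonneg t]) hbig
  rw [Real.log_mul (by norm_num) (by positivity), Real.log_pow] at h1
  rw [Real.log_mul (by norm_num) (by positivity), Real.log_pow]
  push_cast at h1 ⊢
  constructor
  · have h := sum_le_add_half_log t n
    have h2 : 0 ≤ Real.log (t ^ 2 + 5 / 4) := Real.log_nonneg (by nlinarith [sq_nonneg t])
    rw [gammaPhaseDeriv]
    linarith
  · intro h41
    have h := sum_le_half_log (t := t) (by linarith) n
    have h2 : Real.log 40.25 ≤ Real.log (t ^ 2 - 3 / 4) :=
      Real.log_le_log (by norm_num) (by norm_num; linarith)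
    rw [gammaPhaseDeriv]
    linarith

/-- The thresholds 36 and 41 work because `36 + 13/4 < 4π²` and `4.01π² < 41 - 3/4`. -/
theorem exists_abs_gammaPhaseDeriv_bounds (K : ℝ) : ∃ c C : ℝ, 0 < c ∧ 0 < C ∧
    ∃ N : ℕ, ∀ n ≥ N, ∀ t : ℝ, t ^ 2 ≤ K → (41 ≤ t ^ 2 ∨ t ^ 2 ≤ 36) →
      c ≤ |gammaPhaseDeriv n t| ∧ |gammaPhaseDeriv n t| ≤ C := by
  have p1 := Real.pi_gt_d4
  have p2 := Real.pi_lt_d4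
  have c1 : 0 < 1 / 4 * (Real.log 40.25 - Real.log (4.01 * Real.pi ^ 2)) := by
    have : Real.log (4.01 * Real.pi ^ 2) < Real.log 40.25 :=
      Real.log_lt_log (by positivity) (by norm_num at *; nlinarith)
    linarith
  have c2 : 0 < 1 / 4 * (Real.log (4 * Real.pi ^ 2) - Real.log 39.25) := by
    have : Real.log 39.25 < Real.log (4 * Real.pi ^ 2) :=
      Real.log_lt_log (by norm_num) (by norm_num at *; nlinarith)
    linarith
  refine ⟨min (1 / 4 * (Real.log 40.25 - Real.log (4.01 * Real.pi ^ 2)))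
      (1 / 4 * (Real.log (4 * Real.pi ^ 2) - Real.log 39.25)),
    max 1 (max (2 + 1 / 4 * Real.log (4.01 * Real.pi ^ 2))
      (1 / 4 * (Real.log (K + 13 / 4) - Real.log (4 * Real.pi ^ 2)))),
    lt_min c1 c2, lt_of_lt_of_le one_pos (le_max_left _ _), max 1 ⌈1000 * (K + 1)⌉₊, ?_⟩
  intro n hn t ht hreg
  have hn1 : 1 ≤ n := (le_max_left _ _).trans hn
  have hn2 : 1000 * (K + 1) ≤ n :=
    (Nat.le_ceil _).trans (by exact_mod_cast (le_max_right _ _).trans hn)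
  obtain ⟨l1, l2⟩ := le_gammaPhaseDeriv ht hn2
  have u := gammaPhaseDeriv_le hn1 t
  constructor
  · rcases hreg with h | h
    · exact (min_le_left _ _).trans ((l2 h).trans (le_abs_self _))
    · refine (min_le_right _ _).trans (le_trans ?_ (neg_le_abs _))
      have : Real.log (t ^ 2 + 13 / 4) ≤ Real.log 39.25 :=
        Real.log_le_log (by positivity) (by norm_num; linarith)
      linarith
  · refine abs_le.2 ⟨?_, ?_⟩
    · have := (le_max_left _ _).trans (le_max_right 1 (max (2 + 1 / 4 * Real.log (4.01 * Real.pi ^ 2))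
        (1 / 4 * (Real.log (K + 13 / 4) - Real.log (4 * Real.pi ^ 2)))))
      linarith
    · refine (u.trans ?_).trans ((le_max_right _ _).trans (le_max_right _ _))
      have : Real.log (t ^ 2 + 13 / 4) ≤ Real.log (K + 13 / 4) :=
        Real.log_le_log (by positivity) (by linarith)
      linarith

theorem exists_gammaPhase_sub_bounds {a b : ℝ}
    (hreg : ∀ t ∈ Set.Ioo a b, 41 ≤ t ^ 2 ∨ t ^ 2 ≤ 36) : ∃ c C : ℝ, 0 < c ∧ 0 < C ∧
    ∃ N : ℕ, ∀ n ≥ N, ∀ t₁ ∈ Set.Ioo a b, ∀ t₂ ∈ Set.Ioo a b,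
      c * |t₁ - t₂| ≤ |gammaPhase n t₁ - gammaPhase n t₂| ∧
        |gammaPhase n t₁ - gammaPhase n t₂| ≤ C * |t₁ - t₂| := by
  obtain ⟨c, C, hc, hC, N, hN⟩ := exists_abs_gammaPhaseDeriv_bounds (a ^ 2 + b ^ 2)
  refine ⟨c, C, hc, hC, N, fun n hn => ?_⟩
  have key : ∀ t₁ ∈ Set.Ioo a b, ∀ t₂ ∈ Set.Ioo a b, t₁ < t₂ →
      c * |t₁ - t₂| ≤ |gammaPhase n t₁ - gammaPhase n t₂| ∧
        |gammaPhase n t₁ - gammaPhase n t₂| ≤ C * |t₁ - t₂| := by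
    intro t₁ h₁ t₂ h₂ hlt
    obtain ⟨ξ, hξ, heq⟩ := exists_hasDerivAt_eq_slope (gammaPhase n) (gammaPhaseDeriv n) hlt
      (fun x _ => (hasDerivAt_gammaPhase n x).continuousAt.continuousWithinAt)
      (fun x _ => hasDerivAt_gammaPhase n x)
    have hξ' : ξ ∈ Set.Ioo a b := ⟨h₁.1.trans hξ.1, hξ.2.trans h₂.2⟩
    have hsq : ξ ^ 2 ≤ a ^ 2 + b ^ 2 := by
      rcases le_total 0 ξ with h | h
      · nlinarith [hξ'.2, sq_nonneg a]
      · nlinarith [hξ'.1, sq_nonneg b]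
    obtain ⟨l, u⟩ := hN n hn ξ hsq (hreg ξ hξ')
    rw [eq_div_iff (sub_pos.2 hlt).ne'] at heq
    rw [abs_sub_comm (gammaPhase n t₁), abs_sub_comm t₁, ← heq, abs_mul]
    exact ⟨mul_le_mul_of_nonneg_right l (abs_nonneg _), mul_le_mul_of_nonneg_right u (abs_nonneg _)⟩
  intro t₁ h₁ t₂ h₂
  rcases lt_trichotomy t₁ t₂ with h | h | h
  · exact key t₁ h₁ t₂ h₂ h
  · simp [h]
  · rw [abs_sub_comm t₁, abs_sub_comm (gammaPhase n t₁)]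
    exact key t₂ h₂ t₁ h₁ h

/-! ### Phases of Euler's approximations and passage to the limit -/

/-- `φ` is an argument (modulo `2π`) of the nonzero complex number `z`. -/
def HasPhase (z : ℂ) (φ : ℝ) : Prop := z = ‖z‖ * Complex.exp (φ * Complex.I)

theorem HasPhase.mul {z w : ℂ} {φ ψ : ℝ} (hz : HasPhase z φ) (hw : HasPhase w ψ) :
    HasPhase (z * w) (φ + ψ) := by
  unfold HasPhase at *
  rw [norm_mul, Complex.ofReal_add, add_mul, Complex.exp_add]
  conv_lhs => rw [hz, hw]
  push_cast
  ring

theorem HasPhase.inv {z : ℂ} {φ : ℝ} (hz : HasPhase z φ) : HasPhase z⁻¹ (-φ) := by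
  unfold HasPhase at *
  rw [norm_inv, Complex.ofReal_neg, neg_mul, Complex.exp_neg]
  conv_lhs => rw [hz]
  push_cast
  rw [mul_inv]

theorem HasPhase.div {z w : ℂ} {φ ψ : ℝ} (hz : HasPhase z φ) (hw : HasPhase w ψ) :
    HasPhase (z / w) (φ - ψ) := by
  rw [div_eq_mul_inv, sub_eq_add_neg]
  exact hz.mul hw.inv

theorem HasPhase.prod {ι : Type*} (s : Finset ι) {z : ι → ℂ} {φ : ι → ℝ}
    (h : ∀ i, HasPhase (z i) (φ i)) : HasPhase (∏ i ∈ s, z i) (∑ i ∈ s, φ i) := by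
  classical
  induction s using Finset.induction_on with
  | empty => simp [HasPhase]
  | insert i s hi ih =>
    rw [Finset.prod_insert hi, Finset.sum_insert hi]
    exact (h i).mul ih

theorem hasPhase_arctan {z : ℂ} (hz : 0 < z.re) : HasPhase z (Real.arctan (z.im / z.re)) := by
  have h := abs_lt.1 (Complex.abs_arg_lt_pi_div_two_iff.2 (Or.inl hz))
  rw [← Complex.tan_arg, Real.arctan_tan h.1 h.2]
  exact (Complex.norm_mul_exp_arg_mul_I z).symm

theorem hasPhase_cpow {x : ℝ} (hx : 0 < x) (s : ℂ) :
    HasPhase ((x : ℂ) ^ s) (s.im * Real.log x) := by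
  unfold HasPhase
  rw [Complex.norm_cpow_eq_rpow_re_of_pos hx, Real.rpow_def_of_pos hx,
    Complex.cpow_def_of_ne_zero (by exact_mod_cast hx.ne'), ← Complex.ofReal_log hx.le,
    Complex.ofReal_exp, ← Complex.exp_add]
  congr 1
  conv_lhs => rw [← Complex.re_add_im s]
  push_cast
  ring

theorem hasPhase_natCast (n : ℕ) : HasPhase (n : ℂ) 0 := by
  simp [HasPhase]

/-- Euler's approximation to `Gammaℝ (1 / 2 + i t)`. -/
noncomputable def gammaApprox (n : ℕ) (t : ℝ) : ℂ :=
  (Real.pi : ℂ) ^ (-(1 / 2 + Complex.I * (t : ℂ)) / 2)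
    * Complex.GammaSeq ((1 / 2 + Complex.I * (t : ℂ)) / 2) n

theorem hasPhase_gammaApprox {n : ℕ} (hn : 1 ≤ n) (t : ℝ) :
    HasPhase (gammaApprox n t) (gammaPhase n t) := by
  have him : ((1 / 2 + Complex.I * (t : ℂ)) / 2).im = t / 2 := by
    simp
  have hre : ((1 / 2 + Complex.I * (t : ℂ)) / 2).re = 1 / 4 := by
    simp
    norm_num
  have h1 := hasPhase_cpow Real.pi_pos (-(1 / 2 + Complex.I * (t : ℂ)) / 2)
  have h2 := hasPhase_cpow (show (0 : ℝ) < n by exact_mod_cast hn)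
    ((1 / 2 + Complex.I * (t : ℂ)) / 2)
  have h3 := HasPhase.prod (Finset.range (n + 1))
    (z := fun j : ℕ => (1 / 2 + Complex.I * (t : ℂ)) / 2 + j)
    (φ := fun j : ℕ => Real.arctan (t / 2 / (1 / 4 + j))) (fun j => by
      have := hasPhase_arctan (z := (1 / 2 + Complex.I * (t : ℂ)) / 2 + j) (by
        rw [Complex.add_re, hre, Complex.natCast_re]
        positivity)
      rwa [Complex.add_re, Complex.add_im, hre, him, Complex.natCast_re, Complex.natCast_im,
        add_zero] at this)
  have h4 := h1.mul ((h2.mul (hasPhase_natCast n.factorial)).div h3)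
  rw [neg_div, Complex.neg_im, him] at h4
  convert h4 using 1
  · rw [gammaApprox, Complex.GammaSeq, neg_div]
    push_cast
    rfl
  · rw [gammaPhase]
    ring

theorem tendsto_gammaApprox (t : ℝ) :
    Filter.Tendsto (fun n => gammaApprox n t) Filter.atTop
      (nhds (Complex.Gammaℝ (1 / 2 + Complex.I * (t : ℂ)))) :=
  (Complex.GammaSeq_tendsto_Gamma _).const_mul _

theorem HasPhase.abs_im_mul_conj {z w : ℂ} {φ ψ : ℝ} (hz : HasPhase z φ) (hw : HasPhase w ψ) :
    |(z * (starRingEnd ℂ) w).im| = ‖z‖ * ‖w‖ * |Real.sin (φ - ψ)| := by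
  have : z * (starRingEnd ℂ) w
      = ((‖z‖ * ‖w‖ : ℝ) : ℂ) * Complex.exp (((φ - ψ : ℝ) : ℂ) * Complex.I) := by
    conv_lhs => rw [hz, hw]
    rw [map_mul, Complex.conj_ofReal, ← Complex.exp_conj, map_mul, Complex.conj_ofReal,
      Complex.conj_I, Complex.ofReal_sub, sub_mul, sub_eq_add_neg, Complex.exp_add]
    push_cast
    ring_nf
  rw [this, Complex.im_ofReal_mul, Complex.exp_ofReal_mul_I_im, abs_mul, abs_of_nonneg (by positivity)]

/-- Since `|Im (z * conj w)| = ‖z‖ ‖w‖ |sin (φ - ψ)|`, the uniform bound `δ` passes to the limit;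
the phases need not converge. -/
theorem im_mul_conj_ne_zero_of_tendsto {z w : ℕ → ℂ} {a b : ℂ} {φ ψ : ℕ → ℝ} {δ : ℝ}
    (hδ : 0 < δ) (ha : a ≠ 0) (hb : b ≠ 0)
    (hz : Filter.Tendsto z Filter.atTop (nhds a)) (hw : Filter.Tendsto w Filter.atTop (nhds b))
    (h : ∀ᶠ n in Filter.atTop, HasPhase (z n) (φ n) ∧ HasPhase (w n) (ψ n) ∧
      δ ≤ |Real.sin (φ n - ψ n)|) :
    (a * (starRingEnd ℂ) b).im ≠ 0 := by
  have hlim := hz.mul ((Complex.continuous_conj.tendsto b).comp hw)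
  have him : Filter.Tendsto (fun n => |(z n * (starRingEnd ℂ) (w n)).im|) Filter.atTop
      (nhds |(a * (starRingEnd ℂ) b).im|) := ((Complex.continuous_im.tendsto _).comp hlim).abs
  have hnorm := (hz.norm.mul hw.norm).mul_const δ
  have hle := le_of_tendsto_of_tendsto hnorm him (by
    filter_upwards [h] with n hn
    rw [hn.1.abs_im_mul_conj hn.2.1]
    exact mul_le_mul_of_nonneg_left hn.2.2 (by positivity))
  have hpos : 0 < ‖a‖ * ‖b‖ * δ := by positivity
  exact abs_pos.1 (hpos.trans_le hle)

/-! ### Reality of completed zeta and local injectivity -/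

theorem Gammaℝ_criticalLine_ne_zero (t : ℝ) :
    Complex.Gammaℝ (1 / 2 + Complex.I * (t : ℂ)) ≠ 0 :=
  Complex.Gammaℝ_ne_zero_of_re_pos (by simp)

theorem Gammaℝ_conj (s : ℂ) :
    Complex.Gammaℝ ((starRingEnd ℂ) s) = (starRingEnd ℂ) (Complex.Gammaℝ s) := by
  have h2 : (starRingEnd ℂ) s / 2 = (starRingEnd ℂ) (s / 2) := by
    rw [map_div₀, map_ofNat]
  rw [Complex.Gammaℝ_def, Complex.Gammaℝ_def, map_mul, neg_div, neg_div, h2, Complex.Gamma_conj,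
    Complex.cpow_def_of_ne_zero (by exact_mod_cast Real.pi_ne_zero),
    Complex.cpow_def_of_ne_zero (by exact_mod_cast Real.pi_ne_zero), ← Complex.exp_conj,
    map_mul, map_neg, ← Complex.ofReal_log Real.pi_pos.le, Complex.conj_ofReal]

/-- On the critical line `conj s = 1 - s`, so conjugation acts on completed zeta as the functional
equation does. -/
theorem Gammaℝ_mul_zetaCurve_real (t : ℝ) :
    (starRingEnd ℂ) (Complex.Gammaℝ (1 / 2 + Complex.I * (t : ℂ)) * zetaCurve t)
      = Complex.Gammaℝ (1 / 2 + Complex.I * (t : ℂ)) * zetaCurve t := by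
  have hconj : (starRingEnd ℂ) (1 / 2 + Complex.I * (t : ℂ)) = 1 - (1 / 2 + Complex.I * (t : ℂ)) := by
    simp [map_ofNat (starRingEnd ℂ) 2]
    ring
  have hs : (1 / 2 + Complex.I * (t : ℂ)) ≠ 0 := fun h => by
    simpa using congrArg Complex.re h
  have hs' : (1 - (1 / 2 + Complex.I * (t : ℂ))) ≠ 0 := fun h => by
    have := congrArg Complex.re h
    norm_num at this
  have hG := Gammaℝ_criticalLine_ne_zero t
  have hG' := (map_ne_zero (starRingEnd ℂ)).2 hG
  rw [map_mul, zetaCurve, ← riemannZeta_conj, ← Gammaℝ_conj, hconj, riemannZeta_def_of_ne_zero hs,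
    riemannZeta_def_of_ne_zero hs', completedRiemannZeta_one_sub, mul_div_cancel₀ _ hG,
    mul_div_cancel₀]
  rwa [← hconj, Gammaℝ_conj]

/-- Both Gamma factors become real after multiplication by the same nonzero value of zeta, so their
ratio is real. -/
theorem im_Gammaℝ_mul_conj_eq_zero {t₁ t₂ : ℝ} (h : zetaCurve t₁ = zetaCurve t₂)
    (h0 : zetaCurve t₂ ≠ 0) :
    (Complex.Gammaℝ (1 / 2 + Complex.I * (t₁ : ℂ))
      * (starRingEnd ℂ) (Complex.Gammaℝ (1 / 2 + Complex.I * (t₂ : ℂ)))).im = 0 := by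
  have h1 := Gammaℝ_mul_zetaCurve_real t₁
  have h2 := Gammaℝ_mul_zetaCurve_real t₂
  rw [h] at h1
  set G₁ := Complex.Gammaℝ (1 / 2 + Complex.I * (t₁ : ℂ))
  set G₂ := Complex.Gammaℝ (1 / 2 + Complex.I * (t₂ : ℂ))
  set v := zetaCurve t₂
  rw [map_mul] at h1 h2
  have hv : (starRingEnd ℂ) v ≠ 0 := (map_ne_zero _).2 h0
  rw [← Complex.conj_eq_iff_im, map_mul, Complex.conj_conj]
  refine mul_right_cancel₀ (mul_ne_zero hv h0) ?_
  linear_combination G₂ * v * h1 - G₁ * v * h2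

theorem zetaCurve_neg (t : ℝ) : zetaCurve (-t) = (starRingEnd ℂ) (zetaCurve t) := by
  rw [zetaCurve, zetaCurve, ← riemannZeta_conj]
  simp [map_ofNat (starRingEnd ℂ) 2]

theorem eventually_zetaCurve_ne_zero (t : ℝ) : ∀ᶠ u in nhdsWithin t {t}ᶜ, zetaCurve u ≠ 0 := by
  have hcont : Continuous fun u : ℝ => (1 / 2 + Complex.I * (u : ℂ)) := by fun_prop
  have hinj : Function.Injective fun u : ℝ => (1 / 2 + Complex.I * (u : ℂ)) := fun a b h => by
    simpa using h
  have hfin : {u : ℝ | u ∈ Set.Icc (t - 1) (t + 1) ∧ zetaCurve u = 0}.Finite := by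
    have := ((isCompact_Icc (a := t - 1) (b := t + 1)).image hcont).inter_riemannZetaZeros_finite
    refine (this.preimage hinj.injOn).subset ?_
    rintro u ⟨hu, hu0⟩
    exact ⟨⟨u, hu, rfl⟩, hu0⟩
  have h1 : ∀ᶠ u in nhdsWithin t {t}ᶜ, u ∈ Set.Icc (t - 1) (t + 1) :=
    nhdsWithin_le_nhds (Icc_mem_nhds (by linarith) (by linarith))
  have h2 := (hfin.subset (Set.sdiff_subset (t := {t}))).isClosed.isOpen_compl.mem_nhds
    (x := t) (by simp)
  filter_upwards [h1, nhdsWithin_le_nhds h2, self_mem_nhdsWithin] with u hu hu2 hu3 hu0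
  exact hu2 ⟨⟨hu, hu0⟩, hu3⟩

/-- The property of being one-to-one on an open interval around `t`. -/
def InjectiveNear (f : ℝ → ℂ) (t : ℝ) : Prop :=
  ∃ a b : ℝ, t ∈ Set.Ioo a b ∧ Set.InjOn f (Set.Ioo a b)

theorem injectiveNear_zetaCurve_of_phase {t : ℝ} (ht : 41 < t ^ 2 ∨ t ^ 2 < 36) :
    InjectiveNear zetaCurve t := by
  have hopen : IsOpen {u : ℝ | 41 < u ^ 2 ∨ u ^ 2 < 36} :=
    (isOpen_lt continuous_const (continuous_pow 2)).union
      (isOpen_lt (continuous_pow 2) continuous_const)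
  obtain ⟨r, hr, hball⟩ := Metric.isOpen_iff.1 hopen t ht
  rw [Real.ball_eq_Ioo] at hball
  obtain ⟨c, C, hc, hC, N, hN⟩ := exists_gammaPhase_sub_bounds (a := t - r) (b := t + r)
    (fun u hu => (hball hu).imp le_of_lt le_of_lt)
  obtain ⟨d, hd, hzero⟩ := Metric.mem_nhdsWithin_iff.1 (eventually_zetaCurve_ne_zero t)
  rw [Real.ball_eq_Ioo] at hzero
  -- The radius `r` keeps the interval in the region of phase bounds, `d` excludes zeros other than
  -- `t`, and `π / (4C)` keeps phase differences within `π/2`, where `|sin x| ≥ (2/π)|x|`.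
  set e : ℝ := min (min r d) (Real.pi / 4 / C) with he
  have he0 : 0 < e := lt_min (lt_min hr hd) (by positivity)
  have her : e ≤ r := (min_le_left _ _).trans (min_le_left _ _)
  have hed : e ≤ d := (min_le_left _ _).trans (min_le_right _ _)
  have heC : e ≤ Real.pi / 4 / C := min_le_right _ _
  refine ⟨t - e, t + e, ⟨by linarith, by linarith⟩, fun t₁ h₁ t₂ h₂ heq => ?_⟩
  by_contra hne
  have hnz : zetaCurve t₂ ≠ 0 := by
    intro h0
    have aux : ∀ u ∈ Set.Ioo (t - e) (t + e), zetaCurve u = 0 → u = t := fun u hu hu0 => by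
      by_contra hut
      exact hzero ⟨⟨by linarith [hu.1], by linarith [hu.2]⟩, hut⟩ hu0
    exact hne ((aux t₁ h₁ (heq.trans h0)).trans (aux t₂ h₂ h0).symm)
  refine im_mul_conj_ne_zero_of_tendsto (δ := 2 / Real.pi * (c * |t₁ - t₂|))
    (φ := fun n => gammaPhase n t₁) (ψ := fun n => gammaPhase n t₂)
    (by have := abs_pos.2 (sub_ne_zero.2 hne); positivity)
    (Gammaℝ_criticalLine_ne_zero t₁) (Gammaℝ_criticalLine_ne_zero t₂)
    (tendsto_gammaApprox t₁) (tendsto_gammaApprox t₂) ?_ (im_Gammaℝ_mul_conj_eq_zero heq hnz)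
  filter_upwards [Filter.eventually_ge_atTop N, Filter.eventually_ge_atTop 1] with n hn hn1
  refine ⟨hasPhase_gammaApprox hn1 t₁, hasPhase_gammaApprox hn1 t₂, ?_⟩
  obtain ⟨l, u⟩ := hN n hn t₁ ⟨by linarith [h₁.1], by linarith [h₁.2]⟩ t₂
    ⟨by linarith [h₂.1], by linarith [h₂.2]⟩
  have hdist : |t₁ - t₂| ≤ 2 * e := by
    rw [abs_le]
    constructor <;> linarith [h₁.1, h₁.2, h₂.1, h₂.2]
  have hsmall : |gammaPhase n t₁ - gammaPhase n t₂| ≤ Real.pi / 2 := by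
    have : C * e ≤ Real.pi / 4 := by
      rwa [le_div_iff₀ hC, mul_comm] at heC
    nlinarith
  exact (mul_le_mul_of_nonneg_left l (by positivity)).trans (Real.mul_abs_le_abs_sin hsmall)

theorem injectiveNear_zetaCurve_of_deriv_ne_zero {t : ℝ}
    (h : deriv riemannZeta (1 / 2 + Complex.I * (t : ℂ)) ≠ 0) : InjectiveNear zetaCurve t := by
  have hs1 : (1 / 2 + Complex.I * (t : ℂ)) ≠ 1 := fun h => by
    have := congrArg Complex.re h
    norm_num at this
  have han : AnalyticAt ℂ riemannZeta (1 / 2 + Complex.I * (t : ℂ)) :=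
    differentiableOn_riemannZeta.analyticAt (isOpen_compl_singleton.mem_nhds hs1)
  have hleft := han.hasStrictDerivAt.eventually_left_inverse h
  have hcont : Continuous fun u : ℝ => (1 / 2 + Complex.I * (u : ℂ)) := by fun_prop
  obtain ⟨e, he, hball⟩ := Metric.mem_nhds_iff.1 (hcont.continuousAt.eventually hleft)
  rw [Real.ball_eq_Ioo] at hball
  refine ⟨t - e, t + e, ⟨by linarith, by linarith⟩, fun t₁ h₁ t₂ h₂ heq => ?_⟩
  have e1 := hball h₁
  have e2 := hball h₂
  simp only [Set.mem_ofPred_eq] at e1 e2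
  rw [zetaCurve, zetaCurve] at heq
  rw [heq, e2] at e1
  simpa using e1.symm

theorem InjectiveNear.zetaCurve_of_neg {t : ℝ} (h : InjectiveNear zetaCurve (-t)) :
    InjectiveNear zetaCurve t := by
  obtain ⟨a, b, ht, hinj⟩ := h
  refine ⟨-b, -a, ⟨by linarith [ht.2], by linarith [ht.1]⟩, fun t₁ h₁ t₂ h₂ heq => ?_⟩
  refine neg_injective (hinj ⟨by linarith [h₁.2], by linarith [h₁.1]⟩
    ⟨by linarith [h₂.2], by linarith [h₂.1]⟩ ?_)
  rw [zetaCurve_neg, zetaCurve_neg, heq]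

theorem proposition3 : LocallyInjectiveOnReal zetaCurve := by
  intro t
  change InjectiveNear zetaCurve t
  by_cases hreg : 41 < t ^ 2 ∨ t ^ 2 < 36
  · exact injectiveNear_zetaCurve_of_phase hreg
  · simp only [not_or, not_lt] at hreg
    have hpos : ∀ u : ℝ, 0 < u → 36 ≤ u ^ 2 → u ^ 2 ≤ 41 → InjectiveNear zetaCurve u :=
      fun u h0 h1 h2 => injectiveNear_zetaCurve_of_deriv_ne_zero (deriv_riemannZeta_ne_zero h0 h1 h2)
    rcases lt_trichotomy t 0 with h | h | h
    · exact (hpos (-t) (by linarith) (by simpa using hreg.2) (by simpa using hreg.1)).zetaCurve_of_neg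
    · subst h
      norm_num at hreg
    · exact hpos t h hreg.2 hreg.1
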